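/- Let $p\in\{0,1,2\}$ and let $\langle v,w\rangle_p=-\sum_{i\le p}v_iw_i+\sum_{i>p}v_iw_i$ on $\mathbb{R}^3$. Let $\mathbb{S}^2_p=\{x\in\mathbb{R}^3 : \langle x,x\rangle_p=1\}$, with the induced metric $g$, the (para-)complex structure $j_x(v)=-I_p\,(x\times v)$, where $I_p=\mathrm{diag}(-1,\dots,-1,1,\dots,1)$ has $p$ entries $-1$ and $\times$ is the standard cross product, and the Kähler form $\omega=g(j\cdot,\cdot)$. On $\mathbb{S}^2_p\times\mathbb{S}^2_p$, with projections $\pi_1,\pi_2$, let $G=\pi_1^*g-\pi_2^*g$ (a neutral metric), $\Omega_1=\pi_1^*\omega-\pi_2^*\omega$ and $\Omega_2=\pi_1^*\omega+\pi_2^*\omega$. Let $\Sigma$ be a smooth surface and let $F:\Sigma\to\mathbb{S}^2_p\times\mathbb{S}^2_p$ be a $G$-minimal immersion, that is, a smooth immersion whose induced metric $F^*G$ is non-degenerate and whose mean curvature vector with respect to $G$ vanishes identically. Call $F$ $\Omega_k$-Lagrangian if $F^*\Omega_k=0$ at every point of $\Sigma$ (equivalently, the Kähler function $C_k$, defined for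 an oriented $\Sigma$ with area form $\omega_\Sigma$ of $F^*G$ by $F^*\Omega_k=C_k\,\omega_\Sigma$, vanishes identically). Then $F$ is $\Omega_1$-Lagrangian if and only if $F$ is $\Omega_2$-Lagrangian. -/

import Mathlib

open scoped Manifold ContDiff

/-- The space `ℝ³`; only its vector space structure and topology are used. -/
abbrev R3 : Type := Fin 3 → ℝ

/-- The matrix `diag(-1, …, -1, 1, …, 1)` with `p` entries `-1`, acting on `ℝ³`. -/
def signFlip (p : ℕ) (v : R3) : R3 := fun i => if (i : ℕ) < p then -(v i) else v i

/-- The pseudo-Riemannian scalar product `⟨v, w⟩_p = -∑_{i ≤ p} vᵢ wᵢ + ∑_{i > p} vᵢ wᵢ`. -/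
def scal (p : ℕ) (v w : R3) : ℝ := signFlip p v ⬝ᵥ w

/-- The quadric `S²_p = {x ∈ ℝ³ | ⟨x, x⟩_p = 1}`: the round sphere for `p = 0`, de Sitter space for
`p = 1`, and (anti-isometrically) the hyperbolic plane, with two sheets, for `p = 2`. -/
def quadric (p : ℕ) : Set R3 := {x | scal p x x = 1}

/-- The (para-)complex structure `j_x(v) = -x ⊗ v` of `S²_p`, where `x ⊗ v` is the cross product of
`(ℝ³, ⟨·,·⟩_p)`, that is, `diag(-1, …, -1, 1, …, 1) · (x × v)`. -/
def jStr (p : ℕ) (x v : R3) : R3 := -signFlip p (crossProduct x v)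

/-- The Kähler form `ω = g(j·, ·)` of `S²_p` at `x`. -/
def kahlerForm (p : ℕ) (x v w : R3) : ℝ := scal p (jStr p x v) w

/-- The symplectic form `Ω₁ = π₁^* ω - π₂^* ω` of `S²_p × S²_p` at the point `x`. -/
def Omega1 (p : ℕ) (x X Y : R3 × R3) : ℝ :=
  kahlerForm p x.1 X.1 Y.1 - kahlerForm p x.2 X.2 Y.2

/-- The symplectic form `Ω₂ = π₁^* ω + π₂^* ω` of `S²_p × S²_p` at the point `x`. -/
def Omega2 (p : ℕ) (x X Y : R3 × R3) : ℝ :=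
  kahlerForm p x.1 X.1 Y.1 + kahlerForm p x.2 X.2 Y.2

/-- The neutral metric `G = (g, -g)` of `S²_p × S²_p` (extended to `ℝ³ × ℝ³` by the same formula).
On tangent vectors of `S²_p × S²_p` it equals `(-1)^(p+1) Ω_k(J_k ·, ·)` for `J₁ = j ⊕ j`,
`J₂ = j ⊕ -j`. -/
def neutralMetric (p : ℕ) (X Y : R3 × R3) : ℝ := scal p X.1 Y.1 - scal p X.2 Y.2

/-- The orthogonal projection of `ℝ³ × ℝ³` onto the tangent space of `S²_p × S²_p` at `x`. The
tangential part of the flat derivative is the Levi-Civita connection of `G`. -/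
def tangentPart (p : ℕ) (x X : R3 × R3) : R3 × R3 :=
  (X.1 - scal p X.1 x.1 • x.1, X.2 - scal p X.2 x.2 • x.2)

section LocalCoordinates

/-- The partial derivative `∂ᵢ X` at `u` of a map `X` on an open subset of the plane. -/
noncomputable def partialD (X : EuclideanSpace ℝ (Fin 2) → R3 × R3) (i : Fin 2)
    (u : EuclideanSpace ℝ (Fin 2)) : R3 × R3 :=
  fderiv ℝ X u (EuclideanSpace.single i 1)

/-- The matrix `gᵢⱼ = G(∂ᵢ X, ∂ⱼ X)` of the induced metric at `u`. -/
noncomputable def inducedMetric (p : ℕ) (X : EuclideanSpace ℝ (Fin 2) → R3 × R3)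
    (u : EuclideanSpace ℝ (Fin 2)) : Matrix (Fin 2) (Fin 2) ℝ :=
  Matrix.of fun i j => neutralMetric p (partialD X i u) (partialD X j u)

/-- The covariant derivative `∇_{∂ᵢ} ∂ⱼ X` in `S²_p × S²_p` along the parametrized surface `X`. -/
noncomputable def ambientCovD (p : ℕ) (X : EuclideanSpace ℝ (Fin 2) → R3 × R3) (i j : Fin 2)
    (u : EuclideanSpace ℝ (Fin 2)) : R3 × R3 :=
  tangentPart p (X u) (partialD (partialD X j) i u)

/-- The second fundamental form `hᵢⱼ`: the component of `∇_{∂ᵢ} ∂ⱼ X` normal to the surface,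
`hᵢⱼ = ∇_{∂ᵢ} ∂ⱼ X - ∑ₖₗ gᵏˡ G(∇_{∂ᵢ} ∂ⱼ X, ∂ₗ X) ∂ₖ X`. -/
noncomputable def secondFundamentalForm (p : ℕ) (X : EuclideanSpace ℝ (Fin 2) → R3 × R3)
    (i j : Fin 2) (u : EuclideanSpace ℝ (Fin 2)) : R3 × R3 :=
  ambientCovD p X i j u - ∑ k, ∑ l,
    ((inducedMetric p X u)⁻¹ k l * neutralMetric p (ambientCovD p X i j u) (partialD X l u)) •
      partialD X k u

/-- The mean curvature vector `H = ½ ∑ᵢⱼ gⁱʲ hᵢⱼ`. -/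
noncomputable def meanCurvature (p : ℕ) (X : EuclideanSpace ℝ (Fin 2) → R3 × R3)
    (u : EuclideanSpace ℝ (Fin 2)) : R3 × R3 :=
  (1 / 2 : ℝ) • ∑ i, ∑ j, (inducedMetric p X u)⁻¹ i j • secondFundamentalForm p X i j u

end LocalCoordinates

section Surfaces

/-- The differential of `F : M → ℝ³ × ℝ³` at `q`. -/
noncomputable def differential {M : Type*} [TopologicalSpace M]
    [ChartedSpace (EuclideanSpace ℝ (Fin 2)) M] (F : M → R3 × R3) (q : M)
    (v : TangentSpace (𝓡 2) q) : R3 × R3 :=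
  mfderiv (𝓡 2) 𝓘(ℝ, R3 × R3) F q v

/-- `F` is a smooth immersion of the surface `M` into `S²_p × S²_p` whose induced metric `F^* G` is
non-degenerate (Riemannian, negative definite, or Lorentzian). -/
structure IsNondegenerateImmersion {M : Type*} [TopologicalSpace M]
    [ChartedSpace (EuclideanSpace ℝ (Fin 2)) M] (p : ℕ) (F : M → R3 × R3) : Prop where
  mem_fst : ∀ q, (F q).1 ∈ quadric p
  mem_snd : ∀ q, (F q).2 ∈ quadric p
  smooth : ContMDiff (𝓡 2) 𝓘(ℝ, R3 × R3) ∞ F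
  injective : ∀ q, Function.Injective (differential F q)
  nondegenerate : ∀ (q : M) (v : TangentSpace (𝓡 2) q),
    (∀ w, neutralMetric p (differential F q v) (differential F q w) = 0) → v = 0

/-- `F` is a `G`-minimal immersion into `S²_p × S²_p`: the mean curvature vector vanishes, computed
in every chart of the surface (it does not depend on the chart). -/
structure IsGMinimalImmersion {M : Type*} [TopologicalSpace M]
    [ChartedSpace (EuclideanSpace ℝ (Fin 2)) M] (p : ℕ) (F : M → R3 × R3) : Prop extends
    IsNondegenerateImmersion p F where
  minimal : ∀ e ∈ atlas (EuclideanSpace ℝ (Fin 2)) M, ∀ u ∈ e.target,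
    meanCurvature p (F ∘ e.symm) u = 0

/-- The point `q` is `Ω`-Lagrangian: `F^* Ω` vanishes at `q`. Since the area form `ω_Σ` of the
(non-degenerate) induced metric does not vanish, this says that the Kähler function `C`,
`F^* Ω = C ω_Σ`, satisfies `C(q) = 0`, for either orientation of the surface at `q`. -/
def IsLagrangianAt {M : Type*} [TopologicalSpace M]
    [ChartedSpace (EuclideanSpace ℝ (Fin 2)) M]
    (Ω : R3 × R3 → R3 × R3 → R3 × R3 → ℝ) (F : M → R3 × R3) (q : M) : Prop :=
  ∀ v w : TangentSpace (𝓡 2) q, Ω (F q) (differential F q v) (differential F q w) = 0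

/-- `F` is `Ω`-Lagrangian: all points are `Ω`-Lagrangian. -/
def IsLagrangian {M : Type*} [TopologicalSpace M]
    [ChartedSpace (EuclideanSpace ℝ (Fin 2)) M]
    (Ω : R3 × R3 → R3 × R3 → R3 × R3 → ℝ) (F : M → R3 × R3) : Prop :=
  ∀ q, IsLagrangianAt Ω F q

end Surfaces

/-! For the Kähler structure `(G, J₁)` the Ricci form is `Ω₂` up to sign, and for `(G, J₂)` it is
`Ω₁`. On a Lagrangian surface the mean curvature one-form is, up to a constant, a primitive of the
restricted Ricci form. If the surface is also minimal, this one-form is zero, so the other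
symplectic form vanishes too.

The argument is carried out in coordinates, with `σ = 1` for `Ω₁` and `σ = -1` for `Ω₂`, and shows
that the area form of the first projection vanishes. If it does not vanish at a point, both
projections are local diffeomorphisms there, and they induce two metrics `g`, `g'` with equal Gram
determinants. The difference of their connections, lowered with the area form, is a binary cubic
that minimality makes trace-free for the induced metric `g - g'` (`connection_trace_eq_zero`). Since
the trace form vanishes identically, so does its exterior derivative. After the quadratic terms
cancel, only twice the determinant of `g - g'` remains, contradicting non-degeneracy
(`curvature_term_eq_zero`). -/

/-- The determinant of three vectors of `ℝ³`. -/
def det3 (a b c : R3) : ℝ :=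
  a 0 * (b 1 * c 2 - b 2 * c 1) + a 1 * (b 2 * c 0 - b 0 * c 2) + a 2 * (b 0 * c 1 - b 1 * c 0)

lemma kahlerForm_eq_neg_det3 (p : ℕ) (x v w : R3) : kahlerForm p x v w = -det3 x v w := by
  have h (a b : R3) : signFlip p (-signFlip p a) ⬝ᵥ b = -(a ⬝ᵥ b) := by
    simp only [signFlip, dotProduct, Fin.sum_univ_three, Pi.neg_apply]
    split_ifs <;> ring
  rw [kahlerForm, scal, jStr, h]
  simp [det3, dotProduct, Fin.sum_univ_three, cross_apply]
  ring

lemma scal_comm (p : ℕ) (v w : R3) : scal p v w = scal p w v := by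
  simp only [scal, signFlip, dotProduct, Fin.sum_univ_three]
  split_ifs <;> ring

lemma scal_add_left (p : ℕ) (v v' w : R3) : scal p (v + v') w = scal p v w + scal p v' w := by
  simp only [scal, signFlip, dotProduct, Fin.sum_univ_three, Pi.add_apply]
  split_ifs <;> ring

lemma scal_smul_left (p : ℕ) (a : ℝ) (v w : R3) : scal p (a • v) w = a * scal p v w := by
  simp only [scal, signFlip, dotProduct, Fin.sum_univ_three, Pi.smul_apply, smul_eq_mul]
  split_ifs <;> ring

/-- The determinant of the scalar product `⟨·,·⟩_p`. -/
def signDet (p : ℕ) : ℝ := ∏ i : Fin 3, if (i : ℕ) < p then -1 else 1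

/-- The Gram determinant of `x, u, v` reduces to that of `u, v` because `x` is a unit normal. This
turns equality of area forms up to sign into equality of the Gram determinants of the two metrics.
-/
lemma gram_two_of_mem_quadric {p : ℕ} {x u v : R3} (hx : scal p x x = 1)
    (hu : scal p u x = 0) (hv : scal p v x = 0) :
    scal p u u * scal p v v - scal p u v ^ 2 = signDet p * det3 x u v ^ 2 := by
  have key : scal p x x * (scal p u u * scal p v v - scal p u v ^ 2)
      - scal p u x * (scal p u x * scal p v v - scal p u v * scal p v x)
      + scal p v x * (scal p u x * scal p u v - scal p u u * scal p v x)
      = signDet p * det3 x u v ^ 2 := by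
    have h (a b : R3) : scal p a b =
        ∑ i : Fin 3, (if (i : ℕ) < p then -1 else 1) * (a i * b i) := by
      simp only [scal, signFlip, dotProduct]
      refine Finset.sum_congr rfl fun i _ => ?_
      split_ifs <;> ring
    simp only [h, signDet, det3, Fin.sum_univ_three, Fin.prod_univ_three]
    ring
  rw [← key, hx, hu, hv]
  ring

/-- Cramer's rule. Applied to second derivatives, the coefficients of `u` and `v` are Christoffel
symbols. -/
lemma exists_eq_combination {x u v : R3} (h : det3 x u v ≠ 0) (w : R3) :
    ∃ a b c : ℝ, w = a • u + b • v + c • x := by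
  refine ⟨det3 x w v / det3 x u v, det3 x u w / det3 x u v, det3 w u v / det3 x u v, ?_⟩
  ext i
  simp only [Pi.add_apply, Pi.smul_apply, smul_eq_mul]
  field_simp
  fin_cases i <;> simp [det3] <;> ring

section Combination

variable (x u v : R3) (a b c a' b' c' : ℝ)

lemma det3_combination_left : det3 x (a • u + b • v + c • x) u = -(b * det3 x u v) := by
  simp only [det3, Pi.add_apply, Pi.smul_apply, smul_eq_mul]; ring

lemma det3_combination_right : det3 x (a • u + b • v + c • x) v = a * det3 x u v := by
  simp only [det3, Pi.add_apply, Pi.smul_apply, smul_eq_mul]; ring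

lemma det3_combination_mid : det3 u (a • u + b • v + c • x) v = -(c * det3 x u v) := by
  simp only [det3, Pi.add_apply, Pi.smul_apply, smul_eq_mul]; ring

lemma det3_combination_mid' : det3 v (a • u + b • v + c • x) u = c * det3 x u v := by
  simp only [det3, Pi.add_apply, Pi.smul_apply, smul_eq_mul]; ring

lemma det3_combination_combination :
    det3 x (a • u + b • v + c • x) (a' • u + b' • v + c' • x) =
      (a * b' - b * a') * det3 x u v := by
  simp only [det3, Pi.add_apply, Pi.smul_apply, smul_eq_mul]; ring

lemma det3_eq_zero_of_left (y z : R3) : det3 y z y = 0 := by simp only [det3]; ring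

lemma det3_self_right (y z : R3) : det3 y z z = 0 := by simp only [det3]; ring

end Combination

/-! ### Pointwise algebra of the curvature identity -/

/-- If two surfaces in the quadric have the same Christoffel traces (their area forms agree) and the
trace of the difference of their connections with respect to the difference of the metrics is a
closed form, then the curvature term vanishes. -/
lemma curvature_term_eq_zero {e f h e' f' h' a₁ a₂ b₁ b₂ c₁ c₂ A₁ A₂ B₁ B₂ C₁ C₂ E F H : ℝ}
    (hE : E = e - e') (hF : F = f - f') (hH : H = h - h')
    (gram : e * h - f ^ 2 = e' * h' - f' ^ 2)
    (tr₁ : a₁ + b₂ = A₁ + B₂) (tr₂ : b₁ + c₂ = B₁ + C₂)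
    (α₁ : -H * (a₂ - A₂) - 2 * F * (a₁ - A₁) + E * (b₁ - B₁) = 0)
    (α₂ : -H * (b₂ - B₂) - 2 * F * (b₁ - B₁) + E * (c₁ - C₁) = 0)
    (hdet : E * H - F ^ 2 ≠ 0)
    (dα : (-(2 * ((b₁ * f + b₂ * h) - (B₁ * f' + B₂ * h'))) * (b₂ - B₂)
        - 2 * ((a₁ * f + a₂ * h) + (b₁ * e + b₂ * f) - (A₁ * f' + A₂ * h') - (B₁ * e' + B₂ * f'))
          * (b₁ - B₁)
        + 2 * ((a₁ * e + a₂ * f) - (A₁ * e' + A₂ * f')) * (c₁ - C₁))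
      - (-(2 * ((c₁ * f + c₂ * h) - (C₁ * f' + C₂ * h'))) * (a₂ - A₂)
        - 2 * ((b₁ * f + b₂ * h) + (c₁ * e + c₂ * f) - (B₁ * f' + B₂ * h') - (C₁ * e' + C₂ * f'))
          * (a₁ - A₁)
        + 2 * ((b₁ * e + b₂ * f) - (B₁ * e' + B₂ * f')) * (b₁ - B₁))
      + H * 2 * ((b₁ * a₂ - b₂ * a₁) - (B₁ * A₂ - B₂ * A₁))
      - 2 * F * (-(a₁ * c₂ - a₂ * c₁) + (A₁ * C₂ - A₂ * C₁))
      + E * 2 * ((c₁ * b₂ - c₂ * b₁) - (C₁ * B₂ - C₂ * B₁))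
      + (H * (e - e') - 2 * F * (f - f') + E * (h - h')) = 0) : False := by
  -- `P, Q, R, S` are the coefficients of the binary cubic given by the difference of the
  -- connections; equality of the traces leaves only these four.
  obtain ⟨Q, rfl⟩ : ∃ Q, A₁ = a₁ - Q := ⟨a₁ - A₁, by ring⟩
  obtain ⟨P, rfl⟩ : ∃ P, A₂ = a₂ + P := ⟨A₂ - a₂, by ring⟩
  obtain ⟨R, rfl⟩ : ∃ R, B₁ = b₁ - R := ⟨b₁ - B₁, by ring⟩
  obtain ⟨S, rfl⟩ : ∃ S, C₁ = c₁ - S := ⟨c₁ - C₁, by ring⟩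
  obtain rfl : B₂ = b₂ + Q := by linarith
  obtain rfl : C₂ = c₂ + R := by linarith
  obtain rfl : e = e' + E := by linarith
  obtain rfl : f = f' + F := by linarith
  obtain rfl : h = h' + H := by linarith
  -- By `α₁` and `α₂`, `(H, -2F, E)` is orthogonal to `(P, Q, R)` and `(Q, R, S)`, hence parallel to
  -- their cross product, the Hessian of the cubic. By `gram` it is also orthogonal to `(e + e', f +
  -- f', h + h')`, so the Hessian is too.
  have hcross : (4 * e' + 2 * E) * (Q * S - R ^ 2) + (4 * f' + 2 * F) * (R * Q - P * S)
      + (4 * h' + 2 * H) * (P * R - Q ^ 2) = 0 := by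
    refine (mul_eq_zero.mp ?_).resolve_left (mul_ne_zero two_ne_zero hdet)
    linear_combination 4 * (E * (Q * S - R ^ 2) + F * (R * Q - P * S) + H * (P * R - Q ^ 2)) * gram
      + 4 * (Q * (f' * H - h' * F) + R * (h' * E - e' * H) + S * (e' * F - f' * E)) * α₁
      - 4 * (P * (f' * H - h' * F) + Q * (h' * E - e' * H) + R * (e' * F - f' * E)) * α₂
  apply hdet
  linear_combination (1 / 2) * dα - (1 / 2) * hcross - (a₁ + b₂) * α₂ + (b₁ + c₂) * α₁

/-- The pointwise step: `x`, `y` are the components of a surface in `S²_p × S²_p`, with first and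
second partial derivatives as indicated. -/
lemma det3_eq_zero_of_closed {p : ℕ} {σ E F H : ℝ} (hσ : σ * σ = 1)
    {x x₁ x₂ x₁₁ x₁₂ x₂₂ y y₁ y₂ y₁₁ y₁₂ y₂₂ : R3}
    (hx : scal p x x = 1) (hx₁ : scal p x₁ x = 0) (hx₂ : scal p x₂ x = 0)
    (hx₁₁ : scal p x₁₁ x = -scal p x₁ x₁) (hx₁₂ : scal p x₁₂ x = -scal p x₁ x₂)
    (hx₂₂ : scal p x₂₂ x = -scal p x₂ x₂)
    (hy : scal p y y = 1) (hy₁ : scal p y₁ y = 0) (hy₂ : scal p y₂ y = 0)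
    (hy₁₁ : scal p y₁₁ y = -scal p y₁ y₁) (hy₁₂ : scal p y₁₂ y = -scal p y₁ y₂)
    (hy₂₂ : scal p y₂₂ y = -scal p y₂ y₂)
    (hE : E = scal p x₁ x₁ - scal p y₁ y₁) (hF : F = scal p x₁ x₂ - scal p y₁ y₂)
    (hH : H = scal p x₂ x₂ - scal p y₂ y₂) (hdet : E * H - F ^ 2 ≠ 0)
    (hlag : det3 x x₁ x₂ - σ * det3 y y₁ y₂ = 0)
    (sym₁ : det3 x x₁₁ x₂ - σ * det3 y y₁₁ y₂ = det3 x x₁₂ x₁ - σ * det3 y y₁₂ y₁)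
    (sym₂ : det3 x x₁₂ x₂ - σ * det3 y y₁₂ y₂ = det3 x x₂₂ x₁ - σ * det3 y y₂₂ y₁)
    (α₁ : H * (det3 x x₁₁ x₁ - σ * det3 y y₁₁ y₁) - 2 * F * (det3 x x₁₁ x₂ - σ * det3 y y₁₁ y₂)
      + E * (det3 x x₁₂ x₂ - σ * det3 y y₁₂ y₂) = 0)
    (α₂ : H * (det3 x x₁₂ x₁ - σ * det3 y y₁₂ y₁) - 2 * F * (det3 x x₁₂ x₂ - σ * det3 y y₁₂ y₂)
      + E * (det3 x x₂₂ x₂ - σ * det3 y y₂₂ y₂) = 0)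
    (dα :
      (2 * (scal p x₁₂ x₂ - scal p y₁₂ y₂)) * (det3 x x₁₂ x₁ - σ * det3 y y₁₂ y₁)
      - 2 * (scal p x₁₁ x₂ + scal p x₁₂ x₁ - (scal p y₁₁ y₂ + scal p y₁₂ y₁)) *
        (det3 x x₁₂ x₂ - σ * det3 y y₁₂ y₂)
      + (2 * (scal p x₁₁ x₁ - scal p y₁₁ y₁)) * (det3 x x₂₂ x₂ - σ * det3 y y₂₂ y₂)
      - ((2 * (scal p x₂₂ x₂ - scal p y₂₂ y₂)) * (det3 x x₁₁ x₁ - σ * det3 y y₁₁ y₁)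
      - 2 * (scal p x₁₂ x₂ + scal p x₂₂ x₁ - (scal p y₁₂ y₂ + scal p y₂₂ y₁)) *
        (det3 x x₁₁ x₂ - σ * det3 y y₁₁ y₂)
      + (2 * (scal p x₁₂ x₁ - scal p y₁₂ y₁)) * (det3 x x₁₂ x₂ - σ * det3 y y₁₂ y₂))
      + H * (det3 x x₁₂ x₁₁ - σ * det3 y y₁₂ y₁₁ - (det3 x₂ x₁₁ x₁ - σ * det3 y₂ y₁₁ y₁)
        - (det3 x x₁₁ x₁₂ - σ * det3 y y₁₁ y₁₂))
      - 2 * F * (det3 x₁ x₁₂ x₂ - σ * det3 y₁ y₁₂ y₂ - (det3 x x₁₁ x₂₂ - σ * det3 y y₁₁ y₂₂))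
      + E * (det3 x₁ x₂₂ x₂ - σ * det3 y₁ y₂₂ y₂ + (det3 x x₂₂ x₁₂ - σ * det3 y y₂₂ y₁₂)
        - (det3 x x₁₂ x₂₂ - σ * det3 y y₁₂ y₂₂)) = 0) :
    det3 x x₁ x₂ = 0 := by
  by_contra hW
  have hσ0 : σ ≠ 0 := by rintro rfl; simp at hσ
  have hW' : det3 y y₁ y₂ = σ * det3 x x₁ x₂ := by
    linear_combination (-σ) * hlag - det3 y y₁ y₂ * hσ
  have hWy : det3 y y₁ y₂ ≠ 0 := hW' ▸ mul_ne_zero hσ0 hW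
  have gx := gram_two_of_mem_quadric hx hx₁ hx₂
  have gy := gram_two_of_mem_quadric hy hy₁ hy₂
  have gram : scal p x₁ x₁ * scal p x₂ x₂ - scal p x₁ x₂ ^ 2 =
      scal p y₁ y₁ * scal p y₂ y₂ - scal p y₁ y₂ ^ 2 := by
    rw [gx, gy, hW']
    linear_combination (-signDet p * det3 x x₁ x₂ ^ 2) * hσ
  obtain ⟨a₁, a₂, a₃, rfl⟩ := exists_eq_combination hW x₁₁
  obtain ⟨b₁, b₂, b₃, rfl⟩ := exists_eq_combination hW x₁₂
  obtain ⟨c₁, c₂, c₃, rfl⟩ := exists_eq_combination hW x₂₂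
  obtain ⟨A₁, A₂, A₃, rfl⟩ := exists_eq_combination hWy y₁₁
  obtain ⟨B₁, B₂, B₃, rfl⟩ := exists_eq_combination hWy y₁₂
  obtain ⟨C₁, C₂, C₃, rfl⟩ := exists_eq_combination hWy y₂₂
  have hx₁' := scal_comm p x₁ x ▸ hx₁
  have hx₂' := scal_comm p x₂ x ▸ hx₂
  have hy₁' := scal_comm p y₁ y ▸ hy₁
  have hy₂' := scal_comm p y₂ y ▸ hy₂
  -- Gauss formula: the coefficient along the position vector is minus the first fundamental form.
  -- It produces the curvature term.
  simp only [scal_add_left, scal_smul_left, hx, hx₁, hx₂, hy, hy₁, hy₂, mul_zero, zero_add,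
    mul_one] at hx₁₁ hx₁₂ hx₂₂ hy₁₁ hy₁₂ hy₂₂
  subst hx₁₁ hx₁₂ hx₂₂ hy₁₁ hy₁₂ hy₂₂
  -- Determinants in the second factor carry a `σ` that cancels the one in the pairing, so both
  -- signs lead to the same identity.
  have hcancel (a b : ℝ) : σ * (a * (σ * b)) = a * b := by linear_combination a * b * hσ
  simp only [det3_combination_left, det3_combination_right, det3_combination_mid,
    det3_combination_mid', det3_combination_combination, hW', scal_add_left, scal_smul_left,
    hx₁', hx₂', hy₁', hy₂', scal_comm p x₂ x₁, scal_comm p y₂ y₁, mul_neg, hcancel] at sym₁ sym₂ α₁ α₂ dα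
  refine curvature_term_eq_zero (a₁ := a₁) (a₂ := a₂) (b₁ := b₁) (b₂ := b₂) (c₁ := c₁) (c₂ := c₂)
    (A₁ := A₁) (A₂ := A₂) (B₁ := B₁) (B₂ := B₂) (C₁ := C₁) (C₂ := C₂) hE hF hH gram
    ?_ ?_ ?_ ?_ hdet ?_
  all_goals apply mul_left_cancel₀ hW
  · linear_combination sym₁
  · linear_combination sym₂
  · linear_combination α₁
  · linear_combination α₂
  · subst hE hF hH
    linear_combination dα

/-! ### Differentiation along coordinate directions -/

section Calculus

variable {X : EuclideanSpace ℝ (Fin 2) → R3 × R3} {U : Set (EuclideanSpace ℝ (Fin 2))}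
  {u : EuclideanSpace ℝ (Fin 2)}

lemma HasDerivAt.det3 {a b c : ℝ → R3} {a' b' c' : R3} {t : ℝ} (ha : HasDerivAt a a' t)
    (hb : HasDerivAt b b' t) (hc : HasDerivAt c c' t) :
    HasDerivAt (fun t => _root_.det3 (a t) (b t) (c t))
      (_root_.det3 a' (b t) (c t) + _root_.det3 (a t) b' (c t) + _root_.det3 (a t) (b t) c') t := by
  have ha := hasDerivAt_pi.1 ha
  have hb := hasDerivAt_pi.1 hb
  have hc := hasDerivAt_pi.1 hc
  refine ((((ha 0).mul (((hb 1).mul (hc 2)).sub ((hb 2).mul (hc 1)))).add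
    ((ha 1).mul (((hb 2).mul (hc 0)).sub ((hb 0).mul (hc 2))))).add
    ((ha 2).mul (((hb 0).mul (hc 1)).sub ((hb 1).mul (hc 0))))).congr_deriv ?_
  simp only [_root_.det3, Pi.mul_apply, Pi.sub_apply]
  ring

lemma HasDerivAt.scal (p : ℕ) {a b : ℝ → R3} {a' b' : R3} {t : ℝ} (ha : HasDerivAt a a' t)
    (hb : HasDerivAt b b' t) :
    HasDerivAt (fun t => _root_.scal p (a t) (b t))
      (_root_.scal p a' (b t) + _root_.scal p (a t) b') t := by
  have ha := hasDerivAt_pi.1 ha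
  have hb := hasDerivAt_pi.1 hb
  have h (v w : R3) : _root_.scal p v w =
      ∑ i : Fin 3, (if (i : ℕ) < p then -1 else 1) * (v i * w i) := by
    simp only [_root_.scal, signFlip, dotProduct]
    refine Finset.sum_congr rfl fun i _ => ?_
    split_ifs <;> ring
  simp only [h, Fin.sum_univ_three]
  refine (((((ha 0).mul (hb 0)).const_mul _).add (((ha 1).mul (hb 1)).const_mul _)).add
    (((ha 2).mul (hb 2)).const_mul _)).congr_deriv ?_
  ring

lemma ContDiffOn.partialD (hU : IsOpen U) (hX : ContDiffOn ℝ ∞ X U) (i : Fin 2) :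
    ContDiffOn ℝ ∞ (partialD X i) U :=
  (hX.fderiv_of_isOpen hU (by simp)).clm_apply contDiffOn_const

lemma ContDiffOn.hasDerivAt_partialD (hU : IsOpen U) (hX : ContDiffOn ℝ ∞ X U) (hu : u ∈ U)
    (i : Fin 2) :
    HasDerivAt (fun t : ℝ => X (u + t • EuclideanSpace.single i 1)) (_root_.partialD X i u) 0 :=
  (((hX.contDiffAt (hU.mem_nhds hu)).differentiableAt (by simp)).hasFDerivAt.hasLineDerivAt _)

lemma ContDiffOn.partialD_comm (hU : IsOpen U) (hX : ContDiffOn ℝ ∞ X U) (hu : u ∈ U)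
    (i j : Fin 2) :
    _root_.partialD (_root_.partialD X j) i u = _root_.partialD (_root_.partialD X i) j u := by
  have hd : DifferentiableAt ℝ (fderiv ℝ X) u :=
    ((hX.fderiv_of_isOpen hU (m := ∞) (by simp)).contDiffAt (hU.mem_nhds hu)).differentiableAt
      (by simp)
  have h (k : Fin 2) (w : EuclideanSpace ℝ (Fin 2)) :
      fderiv ℝ (_root_.partialD X k) u w =
        fderiv ℝ (fderiv ℝ X) u w (EuclideanSpace.single k 1) := by
    have := hd.hasFDerivAt.clm_apply (hasFDerivAt_const (EuclideanSpace.single k (1 : ℝ)) u)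
    have h2 : fderiv ℝ (_root_.partialD X k) u = _ := this.fderiv
    rw [h2]
    simp
  have hs := (hX.contDiffAt (hU.mem_nhds hu)).isSymmSndFDerivAt
    (by simp only [minSmoothness_of_isRCLikeNormedField]; exact ENat.LEInfty.out)
  rw [_root_.partialD, h, _root_.partialD, h]
  exact hs _ _

lemma deriv_eq_zero_of_const_on (hU : IsOpen U) (hu : u ∈ U) {f : EuclideanSpace ℝ (Fin 2) → ℝ}
    {c f' : ℝ} (hf : ∀ w ∈ U, f w = c) {v : EuclideanSpace ℝ (Fin 2)}
    (h : HasDerivAt (fun t : ℝ => f (u + t • v)) f' 0) : f' = 0 := by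
  have hc : Continuous fun t : ℝ => u + t • v := by fun_prop
  have hev : (fun t : ℝ => f (u + t • v)) =ᶠ[nhds 0] fun _ => c := by
    filter_upwards [hc.continuousAt.preimage_mem_nhds (by simpa using hU.mem_nhds hu)] with t ht
    exact hf _ ht
  exact h.unique ((hasDerivAt_const 0 c).congr_of_eventuallyEq hev)

end Calculus

lemma HasDerivAt.clm {L : R3 × R3 →L[ℝ] R3} {a : ℝ → R3 × R3} {a' : R3 × R3} {t : ℝ}
    (ha : HasDerivAt a a' t) : HasDerivAt (fun t => L (a t)) (L a') t :=
  L.hasFDerivAt.comp_hasDerivAt t ha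

lemma HasDerivAt.fst_comp {a : ℝ → R3 × R3} {a' : R3 × R3} {t : ℝ} (ha : HasDerivAt a a' t) :
    HasDerivAt (fun t => (a t).1) a'.1 t :=
  ha.clm (L := ContinuousLinearMap.fst ℝ R3 R3)

lemma HasDerivAt.snd_comp {a : ℝ → R3 × R3} {a' : R3 × R3} {t : ℝ} (ha : HasDerivAt a a' t) :
    HasDerivAt (fun t => (a t).2) a'.2 t :=
  ha.clm (L := ContinuousLinearMap.snd ℝ R3 R3)

/-- The pairing `G(Y, J Z)` at `x`, up to sign, for `J = j ⊕ j` (`σ = 1`) or `J = j ⊕ -j`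
(`σ = -1`). -/
def pairing (σ : ℝ) (x Y Z : R3 × R3) : ℝ := det3 x.1 Y.1 Z.1 - σ * det3 x.2 Y.2 Z.2

lemma HasDerivAt.pairing (σ : ℝ) {a b c : ℝ → R3 × R3} {a' b' c' : R3 × R3} {t : ℝ}
    (ha : HasDerivAt a a' t) (hb : HasDerivAt b b' t) (hc : HasDerivAt c c' t) :
    HasDerivAt (fun t => _root_.pairing σ (a t) (b t) (c t))
      (_root_.pairing σ a' (b t) (c t) + _root_.pairing σ (a t) b' (c t) +
        _root_.pairing σ (a t) (b t) c') t := by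
  refine ((ha.fst_comp.det3 hb.fst_comp hc.fst_comp).sub ((ha.snd_comp.det3 hb.snd_comp hc.snd_comp).const_mul σ)).congr_deriv ?_
  simp only [_root_.pairing]
  ring

lemma HasDerivAt.neutralMetric (p : ℕ) {a b : ℝ → R3 × R3} {a' b' : R3 × R3} {t : ℝ}
    (ha : HasDerivAt a a' t) (hb : HasDerivAt b b' t) :
    HasDerivAt (fun t => _root_.neutralMetric p (a t) (b t))
      (_root_.neutralMetric p a' (b t) + _root_.neutralMetric p (a t) b') t := by
  refine ((ha.fst_comp.scal p hb.fst_comp).sub (ha.snd_comp.scal p hb.snd_comp)).congr_deriv ?_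
  simp only [_root_.neutralMetric]
  ring

section Pairing

variable (σ : ℝ) (x Y Y' Z : R3 × R3)

lemma pairing_add : pairing σ x (Y + Y') Z = pairing σ x Y Z + pairing σ x Y' Z := by
  simp only [pairing, det3, Prod.fst_add, Prod.snd_add, Pi.add_apply]; ring

lemma pairing_smul (a : ℝ) : pairing σ x (a • Y) Z = a * pairing σ x Y Z := by
  simp only [pairing, det3, Prod.smul_fst, Prod.smul_snd, Pi.smul_apply, smul_eq_mul]; ring

lemma pairing_sub : pairing σ x (Y - Y') Z = pairing σ x Y Z - pairing σ x Y' Z := by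
  simp only [pairing, det3, Prod.fst_sub, Prod.snd_sub, Pi.sub_apply]; ring

lemma pairing_self : pairing σ x Y Y = 0 := by
  simp only [pairing, det3]; ring

lemma pairing_swap : pairing σ x Y Z = -pairing σ x Z Y := by
  simp only [pairing, det3]; ring

lemma pairing_zero : pairing σ x 0 Z = 0 := by
  simp [pairing, det3]

lemma pairing_tangentPart (p : ℕ) : pairing σ x (tangentPart p x Y) Z = pairing σ x Y Z := by
  simp only [pairing, det3, tangentPart, Pi.sub_apply, Pi.smul_apply, smul_eq_mul]; ring

end Pairing

/-! ### Minimal Lagrangian surfaces in coordinates -/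

section Surface

variable {p : ℕ} {σ : ℝ} {X : EuclideanSpace ℝ (Fin 2) → R3 × R3}
  {U : Set (EuclideanSpace ℝ (Fin 2))} {u : EuclideanSpace ℝ (Fin 2)}

/-- The pairing of the mean curvature vector of a Lagrangian surface with the normal fields
`J ∂ₖX`. -/
lemma trace_pairing_eq_zero (hdet : (inducedMetric p X u).det ≠ 0)
    (hmin : meanCurvature p X u = 0)
    (hlag : pairing σ (X u) (partialD X 0 u) (partialD X 1 u) = 0) (k : Fin 2) :
    neutralMetric p (partialD X 1 u) (partialD X 1 u) *
        pairing σ (X u) (partialD (partialD X 0) 0 u) (partialD X k u) -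
      neutralMetric p (partialD X 0 u) (partialD X 1 u) *
        pairing σ (X u) (partialD (partialD X 1) 0 u) (partialD X k u) -
      neutralMetric p (partialD X 1 u) (partialD X 0 u) *
        pairing σ (X u) (partialD (partialD X 0) 1 u) (partialD X k u) +
      neutralMetric p (partialD X 0 u) (partialD X 0 u) *
        pairing σ (X u) (partialD (partialD X 1) 1 u) (partialD X k u) = 0 := by
  have htan (i : Fin 2) : pairing σ (X u) (partialD X i u) (partialD X k u) = 0 := by
    have h' := pairing_swap σ (X u) (partialD X 0 u) (partialD X 1 u)
    fin_cases i <;> fin_cases k <;> simp_all [pairing_self]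
  -- Tangential corrections pair to zero by the Lagrangian condition, and multiples of the position
  -- vectors by a repeated column in the determinant.
  have hsff (i j : Fin 2) : pairing σ (X u) (secondFundamentalForm p X i j u) (partialD X k u) =
      pairing σ (X u) (partialD (partialD X j) i u) (partialD X k u) := by
    simp [secondFundamentalForm, Fin.sum_univ_two, pairing_sub, pairing_add, pairing_smul, htan,
      ambientCovD, pairing_tangentPart]
  have h := congrArg (fun Y => pairing σ (X u) Y (partialD X k u)) hmin
  simp only [meanCurvature, Fin.sum_univ_two, pairing_smul, pairing_add, hsff, pairing_zero,
    Matrix.inv_def, Matrix.adjugate_fin_two, Ring.inverse_eq_inv', Matrix.smul_apply,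
    smul_eq_mul] at h
  simp only [inducedMetric, Matrix.of_apply, Matrix.cons_val_zero, Matrix.cons_val_one,
    Matrix.cons_val'] at h
  change _ = (0 : ℝ) at h
  set d := (inducedMetric p X u).det with hd
  simp only [inducedMetric] at hd
  rw [← hd] at h
  field_simp at h
  simp at h
  linear_combination h

end Surface

section Surface

variable {p : ℕ} {σ : ℝ} {X : EuclideanSpace ℝ (Fin 2) → R3 × R3}
  {U : Set (EuclideanSpace ℝ (Fin 2))} {u : EuclideanSpace ℝ (Fin 2)}

lemma scal_partialD_eq_zero (hU : IsOpen U) (hX : ContDiffOn ℝ ∞ X U) (L : R3 × R3 →L[ℝ] R3)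
    (hL : ∀ w ∈ U, L (X w) ∈ quadric p) (hu : u ∈ U) (i : Fin 2) :
    scal p (L (partialD X i u)) (L (X u)) = 0 := by
  have hd := hX.hasDerivAt_partialD hU hu i
  have h := deriv_eq_zero_of_const_on hU hu (f := fun w => scal p (L (X w)) (L (X w))) hL
    (HasDerivAt.scal p hd.clm hd.clm)
  simp only [zero_smul, add_zero] at h
  rw [scal_comm p (L (X u))] at h
  linarith

lemma scal_partialD_partialD (hU : IsOpen U) (hX : ContDiffOn ℝ ∞ X U) (L : R3 × R3 →L[ℝ] R3)
    (hL : ∀ w ∈ U, L (X w) ∈ quadric p) (hu : u ∈ U) (i j : Fin 2) :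
    scal p (L (partialD (partialD X j) i u)) (L (X u)) =
      -scal p (L (partialD X j u)) (L (partialD X i u)) := by
  have h := deriv_eq_zero_of_const_on hU hu (f := fun w => scal p (L (partialD X j w)) (L (X w)))
    (fun w hw => scal_partialD_eq_zero hU hX L hL hw j)
    (HasDerivAt.scal p ((hX.partialD hU j).hasDerivAt_partialD hU hu i).clm
      (hX.hasDerivAt_partialD hU hu i).clm)
  simp only [zero_smul, add_zero] at h
  linarith

/-- Differentiating the Lagrangian condition gives the symmetry of the cubic form `G(∇ₖ∂ᵢX, J∂ⱼX)`
in `i, j`. It allows the trace over the derivative indices, which minimality controls, to be moved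
to the connection. -/
lemma pairing_partialD_symm (hU : IsOpen U) (hX : ContDiffOn ℝ ∞ X U)
    (hlag : ∀ w ∈ U, pairing σ (X w) (partialD X 0 w) (partialD X 1 w) = 0)
    (hu : u ∈ U) (k : Fin 2) :
    pairing σ (X u) (partialD (partialD X 0) k u) (partialD X 1 u) =
      pairing σ (X u) (partialD (partialD X 1) k u) (partialD X 0 u) := by
  have h := deriv_eq_zero_of_const_on hU hu hlag
    ((hX.hasDerivAt_partialD hU hu k).pairing σ
      ((hX.partialD hU 0).hasDerivAt_partialD hU hu k)
      ((hX.partialD hU 1).hasDerivAt_partialD hU hu k))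
  simp only [zero_smul, add_zero] at h
  have h0 : pairing σ (partialD X k u) (partialD X 0 u) (partialD X 1 u) = 0 := by
    fin_cases k <;> simp only [pairing, det3, Fin.zero_eta, Fin.mk_one] <;> ring
  rw [h0, pairing_swap σ (X u) (partialD X 0 u)] at h
  linarith

/-- On a minimal Lagrangian surface, the trace `∑ gⁱʲ G(∇ₖ∂ᵢX, J∂ⱼX)` of the connection vanishes. -/
lemma connection_trace_eq_zero (hU : IsOpen U) (hX : ContDiffOn ℝ ∞ X U)
    (hdet : ∀ w ∈ U, (inducedMetric p X w).det ≠ 0) (hmin : ∀ w ∈ U, meanCurvature p X w = 0)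
    (hlag : ∀ w ∈ U, pairing σ (X w) (partialD X 0 w) (partialD X 1 w) = 0)
    (hu : u ∈ U) (k : Fin 2) :
    neutralMetric p (partialD X 1 u) (partialD X 1 u) *
        pairing σ (X u) (partialD (partialD X 0) k u) (partialD X 0 u) -
      2 * neutralMetric p (partialD X 0 u) (partialD X 1 u) *
        pairing σ (X u) (partialD (partialD X 0) k u) (partialD X 1 u) +
      neutralMetric p (partialD X 0 u) (partialD X 0 u) *
        pairing σ (X u) (partialD (partialD X 1) k u) (partialD X 1 u) = 0 := by
  have h := trace_pairing_eq_zero (hdet u hu) (hmin u hu) (hlag u hu) k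
  have h0 := pairing_partialD_symm hU hX hlag hu 0
  have h1 := pairing_partialD_symm hU hX hlag hu 1
  have hG : neutralMetric p (partialD X 1 u) (partialD X 0 u) =
      neutralMetric p (partialD X 0 u) (partialD X 1 u) := by
    simp only [neutralMetric, scal_comm p (partialD X 1 u).1, scal_comm p (partialD X 1 u).2]
  simp only [hX.partialD_comm hU hu 0 1, hG] at h h0 h1
  fin_cases k <;> simp only [Fin.zero_eta, Fin.mk_one, hX.partialD_comm hU hu 0 1] at h ⊢
  · linear_combination h - 2 * neutralMetric p (partialD X 0 u) (partialD X 1 u) * h0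
      + neutralMetric p (partialD X 0 u) (partialD X 0 u) * h1
  · linear_combination h - neutralMetric p (partialD X 1 u) (partialD X 1 u) * h0

theorem det3_eq_zero_of_minimal_of_lagrangian (hσ : σ * σ = 1) (hU : IsOpen U)
    (hX : ContDiffOn ℝ ∞ X U)
    (hfst : ∀ w ∈ U, (X w).1 ∈ quadric p) (hsnd : ∀ w ∈ U, (X w).2 ∈ quadric p)
    (hdet : ∀ w ∈ U, (inducedMetric p X w).det ≠ 0) (hmin : ∀ w ∈ U, meanCurvature p X w = 0)
    (hlag : ∀ w ∈ U, pairing σ (X w) (partialD X 0 w) (partialD X 1 w) = 0) (hu : u ∈ U) :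
    det3 (X u).1 (partialD X 0 u).1 (partialD X 1 u).1 = 0 := by
  have hX1 (i : Fin 2) := hX.partialD hU i
  have hX2 (i j : Fin 2) := (hX1 j).partialD hU i
  have d0 (i : Fin 2) := hX.hasDerivAt_partialD hU hu i
  have d1 (i j : Fin 2) := (hX1 j).hasDerivAt_partialD hU hu i
  have d2 (i j k : Fin 2) := (hX2 j k).hasDerivAt_partialD hU hu i
  -- The trace form scaled by the determinant of the metric vanishes on all of `U`, so its
  -- derivatives may be used without differentiating the inverse metric.
  have dα (l k : Fin 2) := deriv_eq_zero_of_const_on hU hu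
    (fun w hw => connection_trace_eq_zero hU hX hdet hmin hlag hw k)
    (((((d1 l 1).neutralMetric p (d1 l 1)).mul ((d0 l).pairing σ (d2 l k 0) (d1 l 0))).sub
      ((((d1 l 0).neutralMetric p (d1 l 1)).const_mul 2).mul
        ((d0 l).pairing σ (d2 l k 0) (d1 l 1)))).add
      (((d1 l 0).neutralMetric p (d1 l 0)).mul ((d0 l).pairing σ (d2 l k 1) (d1 l 1))))
  have dα₁ := dα 1 0
  have dα₂ := dα 0 1
  have s0 := pairing_partialD_symm hU hX hlag hu 0
  have s1 := pairing_partialD_symm hU hX hlag hu 1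
  have t0 := connection_trace_eq_zero hU hX hdet hmin hlag hu 0
  have t1 := connection_trace_eq_zero hU hX hdet hmin hlag hu 1
  have hdu := hdet u hu
  simp only [inducedMetric, Matrix.det_fin_two, Matrix.of_apply] at hdu
  have hG : neutralMetric p (partialD X 1 u) (partialD X 0 u) =
      neutralMetric p (partialD X 0 u) (partialD X 1 u) := by
    simp only [neutralMetric, scal_comm p (partialD X 1 u).1, scal_comm p (partialD X 1 u).2]
  rw [hG] at hdu
  simp only [zero_smul, add_zero, (hX1 _).partialD_comm hU hu 0 1, hX.partialD_comm hU hu 0 1]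
    at dα₁ dα₂ s0 s1 t0 t1
  have q1 := scal_partialD_eq_zero hU hX (ContinuousLinearMap.fst ℝ R3 R3) hfst hu
  have q2 := scal_partialD_eq_zero hU hX (ContinuousLinearMap.snd ℝ R3 R3) hsnd hu
  have r1 := scal_partialD_partialD hU hX (ContinuousLinearMap.fst ℝ R3 R3) hfst hu
  have r2 := scal_partialD_partialD hU hX (ContinuousLinearMap.snd ℝ R3 R3) hsnd hu
  have sc₁ (i j k : Fin 2) := scal_comm p (partialD X k u).1 (partialD (partialD X j) i u).1
  have sc₂ (i j k : Fin 2) := scal_comm p (partialD X k u).2 (partialD (partialD X j) i u).2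
  refine det3_eq_zero_of_closed (p := p) (σ := σ)
    (E := neutralMetric p (partialD X 0 u) (partialD X 0 u))
    (F := neutralMetric p (partialD X 0 u) (partialD X 1 u))
    (H := neutralMetric p (partialD X 1 u) (partialD X 1 u))
    (x₁₁ := (partialD (partialD X 0) 0 u).1) (x₁₂ := (partialD (partialD X 0) 1 u).1)
    (x₂₂ := (partialD (partialD X 1) 1 u).1) (y := (X u).2)
    (y₁ := (partialD X 0 u).2) (y₂ := (partialD X 1 u).2)
    (y₁₁ := (partialD (partialD X 0) 0 u).2) (y₁₂ := (partialD (partialD X 0) 1 u).2)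
    (y₂₂ := (partialD (partialD X 1) 1 u).2)
    hσ (hfst u hu) (q1 0) (q1 1) (r1 0 0) (r1 1 0) (r1 1 1)
    (hsnd u hu) (q2 0) (q2 1) (r2 0 0) (r2 1 0) (r2 1 1) rfl rfl rfl
    (by rwa [sq]) (hlag u hu) s0 s1 t0 t1 ?_
  simp only [pairing, neutralMetric, sc₁, sc₂, det3_eq_zero_of_left, det3_self_right]
    at dα₁ dα₂ ⊢
  -- Antisymmetrizing cancels the third derivatives of `X`.
  linear_combination dα₂ - dα₁

end Surface

/-! ### From charts to the surface -/

section Charts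

variable {p : ℕ} {M : Type*} [TopologicalSpace M] [ChartedSpace (EuclideanSpace ℝ (Fin 2)) M]
  {F : M → R3 × R3} {e : OpenPartialHomeomorph M (EuclideanSpace ℝ (Fin 2))}
  {u : EuclideanSpace ℝ (Fin 2)}

lemma exists_partialD_eq_differential [IsManifold (𝓡 2) ∞ M]
    (hF : ContMDiff (𝓡 2) 𝓘(ℝ, R3 × R3) ∞ F)
    (he : e ∈ atlas (EuclideanSpace ℝ (Fin 2)) M) (hu : u ∈ e.target) :
    ∃ b : EuclideanSpace ℝ (Fin 2) ≃ₗ[ℝ] TangentSpace (𝓡 2) (e.symm u), ∀ v,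
      differential F (e.symm u) (b v) =
        v 0 • partialD (F ∘ e.symm) 0 u + v 1 • partialD (F ∘ e.symm) 1 u := by
  have : IsManifold (𝓡 2) 1 M := .of_le (n := ∞) (by simp)
  have hmd := mdifferentiable_of_mem_atlas (I := 𝓡 2) he
  have hbij := hmd.symm.mfderiv_bijective (x := u) hu
  refine ⟨LinearEquiv.ofBijective (mfderiv (𝓡 2) (𝓡 2) e.symm u).toLinearMap hbij, fun v => ?_⟩
  have hcomp : fderiv ℝ (F ∘ e.symm) u =
      (mfderiv (𝓡 2) 𝓘(ℝ, R3 × R3) F (e.symm u)).comp (mfderiv (𝓡 2) (𝓡 2) e.symm u) := by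
    rw [← mfderiv_eq_fderiv]
    exact mfderiv_comp u ((hF.mdifferentiable (by simp)) _) (hmd.mdifferentiableAt_symm hu)
  have hv : v = v 0 • EuclideanSpace.single 0 1 + v 1 • EuclideanSpace.single 1 1 := by
    ext i; fin_cases i <;> simp
  have h : differential F (e.symm u) (mfderiv (𝓡 2) (𝓡 2) e.symm u v) =
      fderiv ℝ (F ∘ e.symm) u v := by rw [hcomp]; rfl
  change differential F (e.symm u) (mfderiv (𝓡 2) (𝓡 2) e.symm u v) = _
  rw [h]
  conv_lhs => rw [hv]
  rw [map_add, map_smul, map_smul]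
  rfl

lemma IsNondegenerateImmersion.det_inducedMetric_ne_zero [IsManifold (𝓡 2) ∞ M]
    (hF : IsNondegenerateImmersion p F)
    (he : e ∈ atlas (EuclideanSpace ℝ (Fin 2)) M) (hu : u ∈ e.target) :
    (inducedMetric p (F ∘ e.symm) u).det ≠ 0 := by
  intro hdet
  obtain ⟨b, hb⟩ := exists_partialD_eq_differential hF.smooth he hu
  -- A kernel vector of the Gram matrix would be `G`-orthogonal to the whole tangent plane.
  obtain ⟨v, hv, hv0⟩ := Matrix.exists_mulVec_eq_zero_iff.2 hdet
  apply hv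
  have h0 := congrFun hv0 0
  have h1 := congrFun hv0 1
  simp only [inducedMetric, Matrix.mulVec, dotProduct, Fin.sum_univ_two, Matrix.of_apply,
    Pi.zero_apply] at h0 h1
  have hbv : b (WithLp.toLp 2 v) = 0 := by
    refine hF.nondegenerate _ _ fun w => ?_
    obtain ⟨w, rfl⟩ := b.surjective w
    rw [hb, hb]
    simp only [neutralMetric, Prod.fst_add, Prod.snd_add, Prod.smul_fst, Prod.smul_snd,
      scal_add_left, scal_smul_left] at h0 h1 ⊢
    simp only [scal_comm p _ (_ + _), scal_add_left, scal_smul_left]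
    linear_combination w 0 * h0 + w 1 * h1
  have := b.map_eq_zero_iff.1 hbv
  simpa using this

/-- A minimal immersion that is Lagrangian for one of the two symplectic forms (`σ = 1` for `Ω₁`,
`σ = -1` for `Ω₂`) has a degenerate first component. -/
theorem IsGMinimalImmersion.det3_eq_zero [IsManifold (𝓡 2) ∞ M] (hF : IsGMinimalImmersion p F)
    {σ : ℝ} (hσ : σ * σ = 1)
    (hlag : ∀ q v w, pairing σ (F q) (differential F q v) (differential F q w) = 0)
    (q : M) (v w : TangentSpace (𝓡 2) q) :
    det3 (F q).1 (differential F q v).1 (differential F q w).1 = 0 := by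
  obtain ⟨e, he, u, hu, rfl⟩ : ∃ e ∈ atlas (EuclideanSpace ℝ (Fin 2)) M,
      ∃ u ∈ e.target, e.symm u = q :=
    ⟨_, chart_mem_atlas _ q, _, mem_chart_target _ q, (chartAt _ q).left_inv (mem_chart_source _ q)⟩
  have hX : ContDiffOn ℝ ∞ (F ∘ e.symm) e.target := by
    rw [← contMDiffOn_iff_contDiffOn]
    exact hF.smooth.comp_contMDiffOn
      (contMDiffOn_symm_of_mem_maximalAtlas (IsManifold.subset_maximalAtlas he))
  have hdet3 := det3_eq_zero_of_minimal_of_lagrangian hσ e.open_target hX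
    (fun w _ => hF.mem_fst _) (fun w _ => hF.mem_snd _)
    (fun w hw => hF.det_inducedMetric_ne_zero he hw) (hF.minimal e he)
    (fun w hw => by
      obtain ⟨b, hb⟩ := exists_partialD_eq_differential hF.smooth he hw
      have := hlag (e.symm w) (b (EuclideanSpace.single 0 1)) (b (EuclideanSpace.single 1 1))
      simpa [hb] using this) hu
  obtain ⟨b, hb⟩ := exists_partialD_eq_differential hF.smooth he hu
  obtain ⟨v, rfl⟩ := b.surjective v
  obtain ⟨w, rfl⟩ := b.surjective w
  rw [hb, hb]
  simp only [det3, Prod.fst_add, Prod.smul_fst, Pi.add_apply, Pi.smul_apply, smul_eq_mul,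
    Function.comp_apply] at hdet3 ⊢
  linear_combination (v 0 * w 1 - v 1 * w 0) * hdet3

end Charts

lemma Omega1_eq_neg_pairing (p : ℕ) (x Y Z : R3 × R3) : Omega1 p x Y Z = -pairing 1 x Y Z := by
  simp only [Omega1, kahlerForm_eq_neg_det3, pairing]; ring

lemma Omega2_eq_neg_pairing (p : ℕ) (x Y Z : R3 × R3) : Omega2 p x Y Z = -pairing (-1) x Y Z := by
  simp only [Omega2, kahlerForm_eq_neg_det3, pairing]; ring

theorem theorem1 (p : ℕ) (hp : p ≤ 2) {M : Type*} [TopologicalSpace M]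
    [ChartedSpace (EuclideanSpace ℝ (Fin 2)) M] [IsManifold (𝓡 2) ∞ M]
    (F : M → R3 × R3) (hF : IsGMinimalImmersion p F) :
    IsLagrangian (Omega1 p) F ↔ IsLagrangian (Omega2 p) F := by
  simp only [IsLagrangian, IsLagrangianAt, Omega1_eq_neg_pairing, Omega2_eq_neg_pairing,
    neg_eq_zero]
  constructor <;> intro h q v w
  · have h1 := hF.det3_eq_zero (by norm_num) h q v w
    have h2 := h q v w
    simp only [pairing] at h2 ⊢
    -- The two pairings add up to twice the determinant of the first factor, which is zero.
    linear_combination 2 * h1 - h2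
  · have h1 := hF.det3_eq_zero (by norm_num) h q v w
    have h2 := h q v w
    simp only [pairing] at h2 ⊢
    linear_combination 2 * h1 - h2
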